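/- Let $D$ be an integral domain with quotient field $K$, and let $\overline{F}(D)$ be the set of nonzero $D$-submodules of $K$. A semistar operation on $D$ is a map $\star:\overline{F}(D)\to\overline{F}(D)$, $E\mapsto E^\star$, such that for all $0\neq z\in K$ and $E,F\in\overline{F}(D)$: $(zE)^\star=zE^\star$; $E\subseteq F$ implies $E^\star\subseteq F^\star$; $E\subseteq E^\star$; and $(E^\star)^\star=E^\star$. Let $\mathrm{SStar}(D)$ be the set of all semistar operations on $D$, with the Zariski topology, i.e. the topology having as a subbasis of open sets the sets $V_E=\{\star\mid 1\in E^\star\}$, $E\in\overline{F}(D)$. A semistar operation $\star$ is - of finite type if $E^\star=\bigcup\{F^\star\mid F\subseteq E,\ F\in\overline{F}(D)\text{ finitely generated}\}$ for all $E$; - stable if $(E\cap H)^\star=E^\star\cap H^\star$ for all $E,H\in\overline{F}(D)$; - spectral if there is a set $Y\subseteq\mathrm{Spec}(D)$ such that $E^\star=\bigcap_{P\in Y}ED_P$ for all $E$ (the empty intersection being $K$). **Theorem.** For every integral domain $D$, the stable semistar operations of finite type on $D$ are exactly the spectral semistar operations of finite type on $D$, and the set of these operations, with the topology induced by the Zariski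 topology of $\mathrm{SStar}(D)$, is a spectral space: it is $T_0$ and quasi-compact, its quasi-compact open subsets form a basis that is closed under finite intersections, and every irreducible closed subset has a generic point. -/

import Mathlib

open scoped Pointwise

section SemistarDefinitions

variable (D K : Type*) [CommRing D] [IsDomain D] [Field K] [Algebra D K] [IsFractionRing D K]

/-- The set of all nonzero `D`-submodules of the quotient field `K` of the domain `D`. -/
abbrev NonzeroSubmodule : Type _ := {E : Submodule D K // E ≠ ⊥}

variable {D K}

namespace NonzeroSubmodule

/-- The nonzero submodule `zE`, for a nonzero element `z` of `K`. -/
def scale (z : K) (hz : z ≠ 0) (E : NonzeroSubmodule D K) : NonzeroSubmodule D K :=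
  ⟨z • E.1, by
    obtain ⟨e, he, he0⟩ := (Submodule.ne_bot_iff _).1 E.2
    exact (Submodule.ne_bot_iff _).2
      ⟨z • e, Submodule.smul_mem_pointwise_smul e z E.1 he, by simp [hz, he0]⟩⟩

theorem inf_ne_bot (E H : NonzeroSubmodule D K) : E.1 ⊓ H.1 ≠ ⊥ := by
  obtain ⟨e, he, he0⟩ := (Submodule.ne_bot_iff _).1 E.2
  obtain ⟨h, hh, hh0⟩ := (Submodule.ne_bot_iff _).1 H.2
  obtain ⟨a, b, hb, hab⟩ := IsFractionRing.div_surjective (A := D) (h / e)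
  have hb0 : algebraMap D K b ≠ 0 := by
    simpa using nonZeroDivisors.ne_zero hb
  have key : a • e = b • h := by
    rw [Algebra.smul_def, Algebra.smul_def]
    field_simp at hab
    linear_combination hab
  refine (Submodule.ne_bot_iff _).2 ⟨b • h, ⟨?_, H.1.smul_mem b hh⟩, ?_⟩
  · rw [← key]
    exact E.1.smul_mem a he
  · rw [Algebra.smul_def]
    exact mul_ne_zero hb0 hh0

/-- The intersection of two nonzero submodules of `K`; it is again nonzero. -/
def inter (E H : NonzeroSubmodule D K) : NonzeroSubmodule D K :=
  ⟨E.1 ⊓ H.1, inf_ne_bot E H⟩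

end NonzeroSubmodule

variable (D K)

/-- A semistar operation on the domain `D` with quotient field `K`. -/
@[ext]
structure SemistarOperation where
  /-- The map `E ↦ E^⋆` on the nonzero `D`-submodules of `K`. -/
  star : NonzeroSubmodule D K → NonzeroSubmodule D K
  star_scale : ∀ (z : K) (hz : z ≠ 0) (E : NonzeroSubmodule D K),
    star (E.scale z hz) = (star E).scale z hz
  star_mono : ∀ E F : NonzeroSubmodule D K, E ≤ F → star E ≤ star F
  le_star : ∀ E : NonzeroSubmodule D K, E ≤ star E
  star_star : ∀ E : NonzeroSubmodule D K, star (star E) = star E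

variable {D K}

namespace SemistarOperation

/-- The set `V_E` of all semistar operations `⋆` such that `1 ∈ E^⋆`. -/
def V (E : NonzeroSubmodule D K) : Set (SemistarOperation D K) :=
  {s | (1 : K) ∈ (s.star E).1}

/-- The Zariski topology on the set of all semistar operations: the sets `V_E`, for `E` a nonzero
`D`-submodule of `K`, form a subbasis of open sets. -/
instance zariskiTopology : TopologicalSpace (SemistarOperation D K) :=
  TopologicalSpace.generateFrom (Set.range V)

/-- `⋆` is of finite type: `E^⋆` is the union of all `F^⋆`, for `F ⊆ E` nonzero and finitely
generated. -/
def IsFiniteType (s : SemistarOperation D K) : Prop :=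
  ∀ E : NonzeroSubmodule D K,
    ((s.star E).1 : Set K) =
      ⋃ F ∈ {F : NonzeroSubmodule D K | F.1.FG ∧ F ≤ E}, ((s.star F).1 : Set K)

/-- `⋆` is stable: `(E ∩ H)^⋆ = E^⋆ ∩ H^⋆` for all `E` and `H`. -/
def IsStable (s : SemistarOperation D K) : Prop :=
  ∀ E H : NonzeroSubmodule D K, s.star (E.inter H) = (s.star E).inter (s.star H)

/-- The localization `D_P`, as a subalgebra of `K`. -/
noncomputable def localizationAt (K : Type*) [Field K] [Algebra D K] [IsFractionRing D K]
    (P : PrimeSpectrum D) : Subalgebra D K :=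
  Localization.subalgebra.ofField K P.asIdeal.primeCompl P.asIdeal.primeCompl_le_nonZeroDivisors

/-- `⋆` is spectral: there is a set `Y` of prime ideals of `D` such that `E^⋆` is the intersection
of the `E D_P`, `P ∈ Y`, for all `E` (the empty intersection being `K`). -/
def IsSpectral (s : SemistarOperation D K) : Prop :=
  ∃ Y : Set (PrimeSpectrum D), ∀ E : NonzeroSubmodule D K,
    (s.star E).1 = ⨅ P ∈ Y, E.1 * Subalgebra.toSubmodule (localizationAt K P)

variable (D K)

/-- The set of stable semistar operations of finite type. -/
def stableFiniteType : Set (SemistarOperation D K) :=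
  {s | s.IsStable ∧ s.IsFiniteType}

/-- The set of spectral semistar operations of finite type. -/
def spectralFiniteType : Set (SemistarOperation D K) :=
  {s | s.IsSpectral ∧ s.IsFiniteType}

end SemistarOperation

end SemistarDefinitions

open TopologicalSpace Topology

set_option linter.unusedSectionVars false

namespace SemistarOperation

variable {D K : Type*} [CommRing D] [IsDomain D] [Field K] [Algebra D K] [IsFractionRing D K]

/-! A stable operation of finite type is determined by the finitely generated ideals `I` with `1 ∈
I^⋆`: `x ∈ E^⋆` iff `I x ⊆ E` for some such `I` (`mem_star_iff_of_mem_stableFiniteType`). These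
ideals are closed under products; conversely, every `IsMulFamily` defines such an operation.

Spectrality: if `x ∉ E^⋆`, the conductor `(E : x)` is not dense, and Zorn's lemma enlarges it to a
non-dense prime `P` (`exists_prime_of_not_isDense`), so `x ∉ E D_P`.

Topology: the sets `basicOpen I` form a basis, and products of ideals give their intersections. Each
is compact because it has a least element, built from the powers of `I`. For an irreducible `Z`, the
ideals whose basic open meets `Z` are a multiplicative family; if `Z` is closed, their operation is
its generic point. -/

theorem mem_scale_inv {z x : K} (hz : z ≠ 0) (E : NonzeroSubmodule D K) :
    x ∈ (E.scale z⁻¹ (inv_ne_zero hz)).1 ↔ x * z ∈ E.1 := by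
  change x ∈ z⁻¹ • E.1 ↔ _
  constructor
  · intro h
    obtain ⟨y, hy, rfl⟩ := (Submodule.mem_smul_pointwise_iff_exists _ _ _).1 h
    rwa [smul_eq_mul, mul_right_comm, inv_mul_cancel₀ hz, one_mul]
  · intro h
    refine (Submodule.mem_smul_pointwise_iff_exists _ _ _).2 ⟨x * z, h, ?_⟩
    rw [smul_eq_mul]
    field_simp

theorem mem_star_iff_one_mem {x : K} (hx : x ≠ 0) (s : SemistarOperation D K)
    (E : NonzeroSubmodule D K) :
    x ∈ (s.star E).1 ↔ (1 : K) ∈ (s.star (E.scale x⁻¹ (inv_ne_zero hx))).1 := by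
  rw [star_scale, mem_scale_inv hx, one_mul]

/-- For `x ≠ 0` the hypothesis says `I ⊆ x⁻¹E`, so homogeneity and monotonicity suffice; stability
is not needed. -/
theorem mem_star_of_forall_mul_mem (s : SemistarOperation D K) {E I : NonzeroSubmodule D K} {x : K}
    (hI : (1 : K) ∈ (s.star I).1) (h : ∀ i ∈ I.1, i * x ∈ E.1) : x ∈ (s.star E).1 := by
  by_cases hx : x = 0
  · rw [hx]
    exact zero_mem _
  rw [mem_star_iff_one_mem hx]
  exact s.star_mono I _ (fun i hi => (mem_scale_inv hx E).2 (h i hi)) hI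

/-- Each `j ∈ J` lies in `L^⋆`, hence `1 ∈ J^⋆ ⊆ L^⋆⋆ = L^⋆`. -/
theorem one_mem_star_of_mul_le (s : SemistarOperation D K) {I J L : NonzeroSubmodule D K}
    (hI : (1 : K) ∈ (s.star I).1) (hJ : (1 : K) ∈ (s.star J).1) (h : I.1 * J.1 ≤ L.1) :
    (1 : K) ∈ (s.star L).1 := by
  rw [← s.star_star L]
  refine s.star_mono J _ (fun j hj => ?_) hJ
  exact s.mem_star_of_forall_mul_mem hI fun i hi => h (Submodule.mul_mem_mul hi hj)

theorem exists_fg_of_mem_star {s : SemistarOperation D K} (hs : s.IsFiniteType)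
    {E : NonzeroSubmodule D K} {x : K} (hx : x ∈ (s.star E).1) :
    ∃ F : NonzeroSubmodule D K, F.1.FG ∧ F ≤ E ∧ x ∈ (s.star F).1 := by
  have h : x ∈ ((s.star E).1 : Set K) := hx
  rw [hs E] at h
  simp only [Set.mem_iUnion] at h
  obtain ⟨F, hF, hx⟩ := h
  exact ⟨F, hF.1, hF.2, hx⟩

variable (D K) in
/-- The domain `D` itself, as a nonzero submodule of `K`. -/
def unit : NonzeroSubmodule D K :=
  ⟨1, one_ne_zero⟩

theorem one_mem_star_unit (s : SemistarOperation D K) : (1 : K) ∈ (s.star (unit D K)).1 :=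
  s.le_star _ (Submodule.one_le.1 le_rfl)

theorem fg_one : (1 : Submodule D K).FG := by
  rw [Submodule.one_eq_span]
  exact Submodule.fg_span_singleton 1

/-- Stability replaces `E` by `E ∩ D`; finite type then shrinks this to a finitely generated ideal.
-/
theorem exists_fg_le_one {s : SemistarOperation D K} (hs : s ∈ stableFiniteType D K)
    {E : NonzeroSubmodule D K} (h : (1 : K) ∈ (s.star E).1) :
    ∃ I : NonzeroSubmodule D K, I.1.FG ∧ I.1 ≤ 1 ∧ I.1 ≤ E.1 ∧ (1 : K) ∈ (s.star I).1 := by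
  have h1 : (1 : K) ∈ (s.star (E.inter (unit D K))).1 := by
    rw [hs.1]
    exact ⟨h, s.one_mem_star_unit⟩
  obtain ⟨F, hF, hFE, hx⟩ := exists_fg_of_mem_star hs.2 h1
  exact ⟨F, hF, fun x hx => (hFE hx).2, fun x hx => (hFE hx).1, hx⟩

theorem mem_star_iff_of_mem_stableFiniteType {s : SemistarOperation D K}
    (hs : s ∈ stableFiniteType D K) {E : NonzeroSubmodule D K} {x : K} :
    x ∈ (s.star E).1 ↔ ∃ I : NonzeroSubmodule D K, I.1.FG ∧ I.1 ≤ 1 ∧ (1 : K) ∈ (s.star I).1 ∧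
      ∀ i ∈ I.1, i * x ∈ E.1 := by
  refine ⟨fun h => ?_, fun ⟨I, _, _, hI, h⟩ => s.mem_star_of_forall_mul_mem hI h⟩
  by_cases hx : x = 0
  · refine ⟨unit D K, fg_one, le_rfl, s.one_mem_star_unit, fun i _ => ?_⟩
    rw [hx, mul_zero]
    exact zero_mem _
  rw [mem_star_iff_one_mem hx] at h
  obtain ⟨I, hfg, h1, hIE, hI⟩ := exists_fg_le_one hs h
  exact ⟨I, hfg, h1, hI, fun i hi => (mem_scale_inv hx E).1 (hIE hi)⟩

/-! ### Stable operations are spectral -/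

theorem mem_mul_localizationAt_iff (P : PrimeSpectrum D) (E : Submodule D K) (x : K) :
    x ∈ E * Subalgebra.toSubmodule (localizationAt K P) ↔ ∃ a ∉ P.asIdeal, a • x ∈ E := by
  have hne : ∀ a ∉ P.asIdeal, algebraMap D K a ≠ 0 := by
    intro a ha h0
    rw [map_eq_zero_iff _ (IsFractionRing.injective D K)] at h0
    exact ha (h0 ▸ zero_mem _)
  constructor
  · intro h
    induction h using Submodule.mul_induction_on' with
    | mem_mul_mem e he y hy =>
      obtain ⟨b, a, ha, rfl⟩ := hy
      refine ⟨a, ha, ?_⟩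
      have : a • (e * (algebraMap D K b * (algebraMap D K a)⁻¹)) = b • e := by
        rw [Algebra.smul_def, Algebra.smul_def]
        field_simp [hne a ha]
      rw [this]
      exact E.smul_mem b he
    | add y _ z _ hy hz =>
      obtain ⟨a, ha, hay⟩ := hy
      obtain ⟨b, hb, hbz⟩ := hz
      refine ⟨a * b, P.isPrime.mul_notMem ha hb, ?_⟩
      rw [smul_add]
      refine E.add_mem ?_ ?_
      · rw [mul_comm, mul_smul]
        exact E.smul_mem b hay
      · rw [mul_smul]
        exact E.smul_mem a hbz
  · rintro ⟨a, ha, hax⟩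
    have hy : (algebraMap D K a)⁻¹ ∈ Subalgebra.toSubmodule (localizationAt K P) :=
      ⟨1, a, ha, by simp⟩
    have := Submodule.mul_mem_mul hax hy
    rwa [Algebra.smul_def, mul_right_comm, mul_inv_cancel₀ (hne a ha), one_mul] at this

theorem IsSpectral.isStable {s : SemistarOperation D K} (hs : s.IsSpectral) : s.IsStable := by
  obtain ⟨Y, hY⟩ := hs
  have key : ∀ (E : NonzeroSubmodule D K) (x : K), x ∈ (s.star E).1 ↔
      ∀ P ∈ Y, ∃ a ∉ P.asIdeal, a • x ∈ E.1 := by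
    intro E x
    simp only [hY, Submodule.mem_iInf, mem_mul_localizationAt_iff]
  intro E H
  refine le_antisymm (fun x hx => ⟨s.star_mono (E.inter H) E (fun _ h => h.1) hx,
    s.star_mono (E.inter H) H (fun _ h => h.2) hx⟩) ?_
  rintro x ⟨hE, hH⟩
  refine (key _ _).2 fun P hP => ?_
  obtain ⟨a, ha, hax⟩ := (key _ _).1 hE P hP
  obtain ⟨b, hb, hbx⟩ := (key _ _).1 hH P hP
  refine ⟨a * b, P.isPrime.mul_notMem ha hb, ?_, ?_⟩
  · rw [mul_comm, mul_smul]
    exact E.1.smul_mem b hax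
  · rw [mul_smul]
    exact H.1.smul_mem a hbx

/-- The submodule `M` contains a nonzero submodule whose closure contains `1`. -/
def IsDense (s : SemistarOperation D K) (M : Submodule D K) : Prop :=
  ∃ I : NonzeroSubmodule D K, I.1 ≤ M ∧ (1 : K) ∈ (s.star I).1

theorem IsDense.mul {s : SemistarOperation D K} {M N : Submodule D K} (hM : s.IsDense M)
    (hN : s.IsDense N) : s.IsDense (M * N) := by
  obtain ⟨I, hI, h1I⟩ := hM
  obtain ⟨J, hJ, h1J⟩ := hN
  exact ⟨⟨I.1 * J.1, mul_ne_zero I.2 J.2⟩, mul_le_mul' hI hJ,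
    s.one_mem_star_of_mul_le h1I h1J le_rfl⟩

theorem IsDense.mono {s : SemistarOperation D K} {M N : Submodule D K} (hM : s.IsDense M)
    (h : M ≤ N) : s.IsDense N :=
  hM.imp fun _ hI => ⟨hI.1.trans h, hI.2⟩

/-- Finite type gives a finitely generated witness of density, which is a compact element and so
lies in a member of the directed family. This supplies the chain condition for Zorn's lemma. -/
theorem exists_isDense_of_isDense_sSup {s : SemistarOperation D K} (hs : s.IsFiniteType)
    {c : Set (Submodule D K)} (hc : c.Nonempty) (hdir : DirectedOn (· ≤ ·) c)
    (h : s.IsDense (sSup c)) : ∃ M ∈ c, s.IsDense M := by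
  obtain ⟨I, hI, h1⟩ := h
  obtain ⟨F, hF, hFI, h1F⟩ := exists_fg_of_mem_star hs h1
  obtain ⟨M, hM, hFM⟩ := (CompleteLattice.isCompactElement_iff_le_of_directed_sSup_le _ F.1).1
    ((Submodule.fg_iff_compact _).1 hF) c hc hdir (le_trans hFI hI)
  exact ⟨M, hM, F, hFM, h1F⟩

theorem exists_prime_of_not_isDense {s : SemistarOperation D K} (hs : s.IsFiniteType)
    (J : Ideal D) (hJ : ¬ s.IsDense (IsLocalization.coeSubmodule K J)) :
    ∃ P : PrimeSpectrum D, J ≤ P.asIdeal ∧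
      ¬ s.IsDense (IsLocalization.coeSubmodule K P.asIdeal) := by
  obtain ⟨P, hJP, hP⟩ := zorn_le_nonempty₀
    {I : Ideal D | ¬ s.IsDense (IsLocalization.coeSubmodule K I)} (by
      intro c hc hchain y hy
      refine ⟨sSup c, fun hd => ?_, fun z hz => le_sSup hz⟩
      have hmap : IsLocalization.coeSubmodule K (sSup c) =
          sSup (IsLocalization.coeSubmodule K '' c) := by
        simp only [IsLocalization.coeSubmodule, sSup_eq_iSup, Submodule.map_iSup, iSup_image]
      rw [hmap] at hd
      obtain ⟨_, ⟨I, hI, rfl⟩, hId⟩ := exists_isDense_of_isDense_sSup hs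
        (Set.Nonempty.image _ ⟨y, hy⟩)
        (by
          rintro _ ⟨a, ha, rfl⟩ _ ⟨b, hb, rfl⟩
          rcases hchain.total ha hb with hab | hab
          · exact ⟨_, ⟨b, hb, rfl⟩, IsLocalization.coeSubmodule_mono K hab, le_rfl⟩
          · exact ⟨_, ⟨a, ha, rfl⟩, le_rfl, IsLocalization.coeSubmodule_mono K hab⟩) hd
      exact hc hI hId) J hJ
  have hmem : ¬ s.IsDense (IsLocalization.coeSubmodule K P) := hP.prop
  have hlt : ∀ a ∉ P, s.IsDense (IsLocalization.coeSubmodule K (P ⊔ Ideal.span {a})) := by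
    intro a ha
    by_contra hd
    exact ha (hP.le_of_ge hd le_sup_left
      (Ideal.mem_sup_right (Ideal.mem_span_singleton_self a)))
  refine ⟨⟨P, ?_, ?_⟩, hJP, hmem⟩
  · rintro rfl
    refine hmem ⟨unit D K, ?_, s.one_mem_star_unit⟩
    rw [IsLocalization.coeSubmodule_top]
    exact le_rfl
  -- If `a, b ∉ P`, maximality makes `P + (a)` and `P + (b)` dense, hence also their product, which
  -- lies in `P` when `ab ∈ P`.
  · intro a b hab
    by_contra! hcon
    have hd := (hlt a hcon.1).mul (hlt b hcon.2)
    rw [← IsLocalization.coeSubmodule_mul] at hd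
    refine hmem (hd.mono (IsLocalization.coeSubmodule_mono K ?_))
    rw [Ideal.sup_mul, Ideal.mul_sup, Ideal.mul_sup, Ideal.span_singleton_mul_span_singleton]
    exact sup_le (sup_le Ideal.mul_le_right Ideal.mul_le_left)
      (sup_le Ideal.mul_le_right ((Ideal.span_singleton_le_iff_mem _).2 hab))

theorem isSpectral_of_mem_stableFiniteType {s : SemistarOperation D K}
    (hs : s ∈ stableFiniteType D K) : s.IsSpectral := by
  refine ⟨{P | ¬ s.IsDense (IsLocalization.coeSubmodule K P.asIdeal)}, fun E => ?_⟩
  ext x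
  simp only [Submodule.mem_iInf, mem_mul_localizationAt_iff]
  constructor
  · intro hx P hP
    obtain ⟨I, -, hI1, h1, hI⟩ := (mem_star_iff_of_mem_stableFiniteType hs).1 hx
    by_contra! hcon
    refine hP ⟨I, fun i hi => ?_, h1⟩
    obtain ⟨a, rfl⟩ := Submodule.mem_one.1 (hI1 hi)
    refine (IsLocalization.mem_coeSubmodule K _).2 ⟨a, ?_, rfl⟩
    by_contra ha
    exact hcon a ha (by rw [Algebra.smul_def]; exact hI _ hi)
  · intro hx
    by_contra hxs
    -- The conductor of `x` into `E`; were it dense, `x` would lie in `E^⋆`.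
    let J : Ideal D := E.1.comap (LinearMap.toSpanSingleton D K x)
    obtain ⟨P, hJP, hP⟩ := exists_prime_of_not_isDense hs.2 J (by
      rintro ⟨I, hI, h1⟩
      refine hxs (s.mem_star_of_forall_mul_mem h1 fun i hi => ?_)
      obtain ⟨a, ha, rfl⟩ := (IsLocalization.mem_coeSubmodule K _).1 (hI hi)
      rw [← Algebra.smul_def]
      exact ha)
    obtain ⟨a, ha, hax⟩ := hx P hP
    exact ha (hJP hax)

theorem stableFiniteType_eq_spectralFiniteType :
    stableFiniteType D K = spectralFiniteType D K :=
  Set.ext fun _ =>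
    ⟨fun h => ⟨isSpectral_of_mem_stableFiniteType h, h.2⟩, fun h => ⟨h.1.isStable, h.2⟩⟩

/-! ### The operation defined by a multiplicative family of ideals -/

/-- A multiplicatively closed family of nonzero finitely generated ideals of `D`, viewed inside
`K`. -/
structure IsMulFamily (G : Set (Submodule D K)) : Prop where
  one_mem : 1 ∈ G
  mul_mem : ∀ I ∈ G, ∀ J ∈ G, I * J ∈ G
  le_one : ∀ I ∈ G, I ≤ 1
  ne_bot : ∀ I ∈ G, I ≠ ⊥
  fg : ∀ I ∈ G, I.FG


namespace IsMulFamily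

variable {G : Set (Submodule D K)}

/-- The elements multiplied into `E` by some member of the family `G`. -/
def closure (hG : IsMulFamily G) (E : Submodule D K) : Submodule D K where
  carrier := {x | ∃ I ∈ G, ∀ i ∈ I, i * x ∈ E}
  zero_mem' := ⟨1, hG.one_mem, fun i _ => by rw [mul_zero]; exact E.zero_mem⟩
  add_mem' := by
    rintro x y ⟨I, hI, hx⟩ ⟨J, hJ, hy⟩
    refine ⟨I * J, hG.mul_mem I hI J hJ, fun i hi => ?_⟩
    rw [mul_add]
    refine E.add_mem (hx i ?_) (hy i ?_)
    · exact (mul_le_of_le_one_right' (hG.le_one J hJ) : I * J ≤ I) hi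
    · exact (mul_le_of_le_one_left' (hG.le_one I hI) : I * J ≤ J) hi
  smul_mem' := by
    rintro a x ⟨I, hI, hx⟩
    refine ⟨I, hI, fun i hi => ?_⟩
    rw [mul_smul_comm]
    exact E.smul_mem a (hx i hi)

theorem mem_closure (hG : IsMulFamily G) {E : Submodule D K} {x : K} :
    x ∈ hG.closure E ↔ ∃ I ∈ G, ∀ i ∈ I, i * x ∈ E :=
  Iff.rfl

theorem le_closure (hG : IsMulFamily G) (E : Submodule D K) : E ≤ hG.closure E := by
  refine fun x hx => ⟨1, hG.one_mem, fun i hi => ?_⟩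
  obtain ⟨a, rfl⟩ := Submodule.mem_one.1 hi
  rw [← Algebra.smul_def]
  exact E.smul_mem a hx

theorem closure_mono (hG : IsMulFamily G) {E F : Submodule D K} (h : E ≤ F) :
    hG.closure E ≤ hG.closure F :=
  fun _ ⟨I, hI, hx⟩ => ⟨I, hI, fun i hi => h (hx i hi)⟩

/-- One member of the family serves finitely many generators: multiply those that serve each.
Idempotence of the closure rests on this, through the finite generation of the members of `G`. -/
theorem exists_mul_le_of_le_closure (hG : IsMulFamily G) {E M : Submodule D K} (hM : M.FG)
    (h : M ≤ hG.closure E) : ∃ J ∈ G, J * M ≤ E := by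
  induction M, hM using Submodule.fg_induction with
  | singleton x =>
    obtain ⟨J, hJ, hx⟩ := h (Submodule.mem_span_singleton_self x)
    refine ⟨J, hJ, Submodule.mul_le.2 fun j hj y hy => ?_⟩
    obtain ⟨a, rfl⟩ := Submodule.mem_span_singleton.1 hy
    rw [mul_smul_comm]
    exact E.smul_mem a (hx j hj)
  | sup M₁ M₂ _ _ ih₁ ih₂ =>
    obtain ⟨J₁, hJ₁, h₁⟩ := ih₁ (le_sup_left.trans h)
    obtain ⟨J₂, hJ₂, h₂⟩ := ih₂ (le_sup_right.trans h)
    refine ⟨J₁ * J₂, hG.mul_mem _ hJ₁ _ hJ₂, ?_⟩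
    rw [Submodule.mul_sup]
    exact sup_le
      ((mul_le_mul_left (mul_le_of_le_one_right' (hG.le_one J₂ hJ₂)) M₁).trans h₁)
      ((mul_le_mul_left (mul_le_of_le_one_left' (hG.le_one J₁ hJ₁)) M₂).trans h₂)

theorem closure_closure (hG : IsMulFamily G) (E : Submodule D K) :
    hG.closure (hG.closure E) = hG.closure E := by
  refine le_antisymm ?_ (hG.le_closure _)
  rintro x ⟨I, hI, hx⟩
  obtain ⟨J, hJ, h⟩ := hG.exists_mul_le_of_le_closure (E := E) (M := I * Submodule.span D {x})
    ((hG.fg I hI).mul (Submodule.fg_span_singleton x)) (Submodule.mul_le.2 fun i hi y hy => by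
      obtain ⟨a, rfl⟩ := Submodule.mem_span_singleton.1 hy
      rw [mul_smul_comm]
      exact Submodule.smul_mem _ a (hx i hi))
  refine ⟨J * I, hG.mul_mem J hJ I hI, fun i hi => h ?_⟩
  rw [← mul_assoc]
  exact Submodule.mul_mem_mul hi (Submodule.mem_span_singleton_self x)

theorem closure_smul (hG : IsMulFamily G) {z : K} (hz : z ≠ 0) (E : Submodule D K) :
    hG.closure (z • E) = z • hG.closure E := by
  have hmem : ∀ (M : Submodule D K) (x : K), x ∈ z • M ↔ z⁻¹ * x ∈ M := by
    intro M x
    rw [Submodule.mem_smul_pointwise_iff_exists]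
    constructor
    · rintro ⟨y, hy, rfl⟩
      rwa [smul_eq_mul, inv_mul_cancel_left₀ hz]
    · exact fun h => ⟨_, h, by rw [smul_eq_mul, mul_inv_cancel_left₀ hz]⟩
  ext x
  simp only [hmem, mem_closure, mul_left_comm]

/-- The semistar operation defined by a multiplicative family of ideals. -/
def operation (hG : IsMulFamily G) : SemistarOperation D K where
  star E := ⟨hG.closure E.1, ne_bot_of_le_ne_bot E.2 (hG.le_closure E.1)⟩
  star_scale _ hz E := Subtype.ext (hG.closure_smul hz E.1)
  star_mono _ _ h := hG.closure_mono h
  le_star E := hG.le_closure E.1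
  star_star E := Subtype.ext (hG.closure_closure E.1)

theorem mem_operation_star (hG : IsMulFamily G) {E : NonzeroSubmodule D K} {x : K} :
    x ∈ (hG.operation.star E).1 ↔ ∃ I ∈ G, ∀ i ∈ I, i * x ∈ E.1 :=
  Iff.rfl

theorem one_mem_operation_star (hG : IsMulFamily G) {E : NonzeroSubmodule D K} :
    (1 : K) ∈ (hG.operation.star E).1 ↔ ∃ I ∈ G, I ≤ E.1 := by
  simp only [mem_operation_star, mul_one, SetLike.le_def]

theorem isStable_operation (hG : IsMulFamily G) : hG.operation.IsStable := by
  refine fun E H => le_antisymm (fun x hx => ⟨hG.closure_mono inf_le_left hx,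
    hG.closure_mono inf_le_right hx⟩) ?_
  rintro x ⟨⟨I, hI, hx⟩, ⟨J, hJ, hy⟩⟩
  exact ⟨I * J, hG.mul_mem I hI J hJ, fun i hi =>
    ⟨hx i ((mul_le_of_le_one_right' (hG.le_one J hJ) : I * J ≤ I) hi),
      hy i ((mul_le_of_le_one_left' (hG.le_one I hI) : I * J ≤ J) hi)⟩⟩

theorem isFiniteType_operation (hG : IsMulFamily G) : hG.operation.IsFiniteType := by
  intro E
  refine Set.Subset.antisymm (fun x hx => ?_) (Set.iUnion₂_subset fun F hF =>
    hG.operation.star_mono F E hF.2)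
  simp only [Set.mem_iUnion]
  -- The witness `I x` used below vanishes for `x = 0`, where any nonzero cyclic submodule of `E`
  -- will do.
  by_cases hx0 : x = 0
  · obtain ⟨e, he, he0⟩ := (Submodule.ne_bot_iff _).1 E.2
    refine ⟨⟨Submodule.span D {e}, by simpa using he0⟩, ⟨Submodule.fg_span_singleton e,
      (Submodule.span_singleton_le_iff_mem e E.1).2 he⟩, ?_⟩
    rw [hx0]
    exact zero_mem _
  obtain ⟨I, hI, h⟩ := hx
  refine ⟨⟨I * Submodule.span D {x}, mul_ne_zero (hG.ne_bot I hI) (by simpa using hx0)⟩,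
    ⟨(hG.fg I hI).mul (Submodule.fg_span_singleton x), Submodule.mul_le.2 fun i hi y hy => ?_⟩,
    I, hI, fun i hi => Submodule.mul_mem_mul hi (Submodule.mem_span_singleton_self x)⟩
  obtain ⟨a, rfl⟩ := Submodule.mem_span_singleton.1 hy
  rw [mul_smul_comm]
  exact E.1.smul_mem a (h i hi)

theorem operation_mem (hG : IsMulFamily G) : hG.operation ∈ stableFiniteType D K :=
  ⟨hG.isStable_operation, hG.isFiniteType_operation⟩

theorem powers {I : Submodule D K} (h0 : I ≠ ⊥) (hfg : I.FG) (h1 : I ≤ 1) :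
    IsMulFamily (Set.range fun n : ℕ => I ^ n) where
  one_mem := ⟨0, pow_zero I⟩
  mul_mem := by
    rintro _ ⟨m, rfl⟩ _ ⟨n, rfl⟩
    exact ⟨m + n, pow_add I m n⟩
  le_one := by
    rintro _ ⟨n, rfl⟩
    exact pow_le_one' h1 n
  ne_bot := by
    rintro _ ⟨n, rfl⟩
    exact pow_ne_zero n h0
  fg := by
    rintro _ ⟨n, rfl⟩
    exact hfg.pow n

end IsMulFamily

/-! ### The topology on the stable operations of finite type -/

variable (D K) in
/-- The nonzero finitely generated ideals of `D`, viewed inside `K`. -/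
abbrev FGIdeal : Type _ := {I : NonzeroSubmodule D K // I.1.FG ∧ I.1 ≤ 1}

namespace FGIdeal

/-- The product of two nonzero finitely generated ideals. -/
def mul (I J : FGIdeal D K) : FGIdeal D K :=
  ⟨⟨I.1.1 * J.1.1, mul_ne_zero I.1.2 J.1.2⟩, I.2.1.mul J.2.1, mul_le_one' I.2.2 J.2.2⟩

/-- The set of stable operations of finite type whose value at `I` contains `1`. -/
def basicOpen (I : FGIdeal D K) : Set (stableFiniteType D K) :=
  {s | (1 : K) ∈ (s.1.star I.1).1}

theorem basicOpen_mono {I J : FGIdeal D K} (h : I.1 ≤ J.1) : basicOpen I ⊆ basicOpen J :=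
  fun s hs => s.1.star_mono _ _ h hs

theorem basicOpen_mul (I J : FGIdeal D K) :
    basicOpen (I.mul J) = basicOpen I ∩ basicOpen J :=
  Set.Subset.antisymm (Set.subset_inter
    (basicOpen_mono (show I.1.1 * J.1.1 ≤ I.1.1 from mul_le_of_le_one_right' J.2.2))
    (basicOpen_mono (show I.1.1 * J.1.1 ≤ J.1.1 from mul_le_of_le_one_left' I.2.2)))
    fun s hs => s.1.one_mem_star_of_mul_le hs.1 hs.2 le_rfl

variable (D K) in
/-- The domain `D` as an ideal of itself. -/
def unit : FGIdeal D K :=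
  ⟨SemistarOperation.unit D K, fg_one, le_rfl⟩

theorem basicOpen_unit : basicOpen (unit D K) = Set.univ :=
  Set.eq_univ_of_forall fun s => s.1.one_mem_star_unit

theorem isOpen_basicOpen (I : FGIdeal D K) : IsOpen (basicOpen I) :=
  (isOpen_generateFrom_of_mem (Set.mem_range_self I.1)).preimage continuous_subtype_val

theorem isTopologicalBasis_basicOpen :
    IsTopologicalBasis (Set.range (basicOpen (D := D) (K := K))) := by
  refine isTopologicalBasis_of_isOpen_of_nhds ?_ ?_
  · rintro _ ⟨I, rfl⟩
    exact isOpen_basicOpen I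
  · rintro s _ hs ⟨U, hU, rfl⟩
    suffices h : ∃ I, s ∈ basicOpen I ∧ basicOpen I ⊆ Subtype.val ⁻¹' U by
      obtain ⟨I, hI⟩ := h
      exact ⟨_, ⟨I, rfl⟩, hI⟩
    induction hU with
    | basic _ h =>
      obtain ⟨E, rfl⟩ := h
      obtain ⟨I, hfg, h1, hIE, hI⟩ := exists_fg_le_one s.2 hs
      exact ⟨⟨I, hfg, h1⟩, hI, fun t ht => t.1.star_mono I E hIE ht⟩
    | univ => exact ⟨unit D K, s.1.one_mem_star_unit, fun _ _ => trivial⟩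
    | inter U V _ _ ihU ihV =>
      obtain ⟨I, hsI, hI⟩ := ihU hs.1
      obtain ⟨J, hsJ, hJ⟩ := ihV hs.2
      refine ⟨I.mul J, ?_, ?_⟩ <;> rw [basicOpen_mul]
      · exact ⟨hsI, hsJ⟩
      · exact Set.inter_subset_inter hI hJ
    | sUnion S _ ih =>
      obtain ⟨U, hU, hsU⟩ := hs
      obtain ⟨I, hsI, hI⟩ := ih U hU hsU
      exact ⟨I, hsI, fun t ht => ⟨U, hU, hI ht⟩⟩

/-- The least operation whose value at `I` contains `1`. -/
def least (I : FGIdeal D K) : stableFiniteType D K :=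
  ⟨_, (IsMulFamily.powers I.1.2 I.2.1 I.2.2).operation_mem⟩

theorem least_mem_basicOpen_iff {I J : FGIdeal D K} :
    least I ∈ basicOpen J ↔ ∃ n : ℕ, I.1.1 ^ n ≤ J.1.1 := by
  refine (IsMulFamily.powers I.1.2 I.2.1 I.2.2).one_mem_operation_star.trans ?_
  simp

theorem basicOpen_subset_of_least_mem {I J : FGIdeal D K} (h : least I ∈ basicOpen J) :
    basicOpen I ⊆ basicOpen J := by
  obtain ⟨n, hn⟩ := least_mem_basicOpen_iff.1 h
  intro s hs
  have hpow : ∀ n : ℕ, (1 : K) ∈ (s.1.star ⟨I.1.1 ^ n, pow_ne_zero n I.1.2⟩).1 := by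
    intro n
    induction n with
    | zero => exact s.1.star_mono _ _ (pow_zero I.1.1).ge s.1.one_mem_star_unit
    | succ n ih => exact s.1.one_mem_star_of_mul_le ih hs (pow_succ I.1.1 n).ge
  exact s.1.star_mono _ _ hn (hpow n)

/-- Any open set of the cover that contains `least I` already contains all of `basicOpen I`. -/
theorem isCompact_basicOpen (I : FGIdeal D K) : IsCompact (basicOpen I) := by
  have hI : least I ∈ basicOpen I := least_mem_basicOpen_iff.2 ⟨1, (pow_one _).le⟩
  refine isCompact_of_finite_subcover fun U hU hcover => ?_
  obtain ⟨i, hi⟩ := Set.mem_iUnion.1 (hcover hI)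
  obtain ⟨_, ⟨J, rfl⟩, hJ, hJU⟩ := isTopologicalBasis_basicOpen.exists_subset_of_mem_open hi (hU i)
  exact ⟨{i}, by simpa using (basicOpen_subset_of_least_mem hJ).trans hJU⟩

theorem eq_of_forall_mem_basicOpen_iff {s t : stableFiniteType D K}
    (h : ∀ I : FGIdeal D K, s ∈ basicOpen I ↔ t ∈ basicOpen I) : s = t := by
  refine Subtype.ext (SemistarOperation.ext (funext fun E =>
    Subtype.ext (Submodule.ext fun x => ?_)))
  rw [mem_star_iff_of_mem_stableFiniteType s.2, mem_star_iff_of_mem_stableFiniteType t.2]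
  exact exists_congr fun I => ⟨fun ⟨hfg, h1, hI, hx⟩ => ⟨hfg, h1, (h ⟨I, hfg, h1⟩).1 hI, hx⟩,
    fun ⟨hfg, h1, hI, hx⟩ => ⟨hfg, h1, (h ⟨I, hfg, h1⟩).2 hI, hx⟩⟩

/-- The finitely generated ideals whose basic open set meets an irreducible set form a
multiplicative family. -/
theorem isMulFamily_of_isIrreducible {Z : Set (stableFiniteType D K)} (hZ : IsIrreducible Z) :
    IsMulFamily {M : Submodule D K |
      ∃ I : FGIdeal D K, I.1.1 = M ∧ (Z ∩ basicOpen I).Nonempty} where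
  one_mem := ⟨unit D K, rfl, by rw [basicOpen_unit, Set.inter_univ]; exact hZ.1⟩
  mul_mem := by
    rintro _ ⟨I, rfl, hI⟩ _ ⟨J, rfl, hJ⟩
    refine ⟨I.mul J, rfl, ?_⟩
    rw [basicOpen_mul]
    exact hZ.2 _ _ (isOpen_basicOpen I) (isOpen_basicOpen J) hI hJ
  le_one := by
    rintro _ ⟨I, rfl, -⟩
    exact I.2.2
  ne_bot := by
    rintro _ ⟨I, rfl, -⟩
    exact I.1.2
  fg := by
    rintro _ ⟨I, rfl, -⟩
    exact I.2.1

theorem exists_isGenericPoint {Z : Set (stableFiniteType D K)} (hZ : IsIrreducible Z)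
    (hclosed : IsClosed Z) : ∃ g, IsGenericPoint g Z := by
  let g : stableFiniteType D K := ⟨_, (isMulFamily_of_isIrreducible hZ).operation_mem⟩
  -- Both inclusions of the generic point claim follow from this: `g` and `Z` meet the same basic
  -- open sets.
  have hg : ∀ I : FGIdeal D K, g ∈ basicOpen I ↔ (Z ∩ basicOpen I).Nonempty := by
    refine fun I => (isMulFamily_of_isIrreducible hZ).one_mem_operation_star.trans
      ⟨?_, fun h => ⟨_, ⟨I, rfl, h⟩, le_rfl⟩⟩
    rintro ⟨_, ⟨J, rfl, hJ⟩, hJI⟩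
    exact hJ.mono (Set.inter_subset_inter_right _ (basicOpen_mono hJI))
  refine ⟨g, Set.Subset.antisymm (hclosed.closure_subset_iff.2 (Set.singleton_subset_iff.2 ?_)) ?_⟩
  · rw [← hclosed.closure_eq, isTopologicalBasis_basicOpen.mem_closure_iff]
    rintro _ ⟨I, rfl⟩ hI
    rw [Set.inter_comm]
    exact (hg I).1 hI
  · intro z hz
    rw [isTopologicalBasis_basicOpen.mem_closure_iff]
    rintro _ ⟨I, rfl⟩ hI
    exact ⟨g, (hg I).2 ⟨z, hz, hI⟩, rfl⟩

end FGIdeal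

open FGIdeal

theorem spectralSpace_stableFiniteType : SpectralSpace (stableFiniteType D K) :=
  have : T0Space (stableFiniteType D K) := ⟨fun _ _ hst => eq_of_forall_mem_basicOpen_iff fun I =>
    hst.mem_open_iff (isOpen_basicOpen I)⟩
  have : CompactSpace (stableFiniteType D K) :=
    ⟨basicOpen_unit (D := D) (K := K) ▸ isCompact_basicOpen (FGIdeal.unit D K)⟩
  have : QuasiSober (stableFiniteType D K) := ⟨exists_isGenericPoint⟩
  have : QuasiSeparatedSpace (stableFiniteType D K) :=
    .of_isTopologicalBasis isTopologicalBasis_basicOpen fun I J =>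
      basicOpen_mul I J ▸ isCompact_basicOpen (I.mul J)
  have : PrespectralSpace (stableFiniteType D K) :=
    .of_isTopologicalBasis' isTopologicalBasis_basicOpen isCompact_basicOpen
  { }

end SemistarOperation

/-- The stable semistar operations of finite type are the spectral ones of finite type, and they
form a spectral space in the topology induced by the Zariski topology. -/
theorem theorem4p6 (D K : Type*) [CommRing D] [IsDomain D] [Field K] [Algebra D K]
    [IsFractionRing D K] :
    SemistarOperation.stableFiniteType D K = SemistarOperation.spectralFiniteType D K ∧
      SpectralSpace (SemistarOperation.stableFiniteType D K) :=
  ⟨SemistarOperation.stableFiniteType_eq_spectralFiniteType,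
    SemistarOperation.spectralSpace_stableFiniteType⟩
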